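/- Let $G=(V,E)$ be a (multi)graph with finitely many edges, let $F\subseteq E$, and let $w\subseteq V$ be a set of vertices (a node of the current graph, which has edge set $F$ and arises from $G$ by deleting and contracting edges). Let $\delta(w)\subseteq F$ be the set of edges of $F$ with exactly one endpoint in $w$ and, for $v\in w$, let $S_v\subseteq\delta(w)$ be the set of edges of $\delta(w)$ that are incident to $v$; these sets partition $\delta(w)$. For every $v\in w$ let $N_v$ be a matroid with ground set $S_v$, and let $N_w$ be the disjoint union (direct sum) of the matroids $N_v$, $v\in w$. For a matroid $M$ with ground set $S$ and rank function $r$, let $P_M=\{y\in\mathbb{R}^S_{\ge 0} : y(A)\le r(A)\ \forall A\subseteq S\}$ be its matroid polytope, where $y(A)=\sum_{e\in A}y(e)$. Let $x\in\mathbb{R}^E$ satisfy $x|_{\delta(w)}\in P_{N_w}$, and let $U\subseteq\delta(w)$. *Removing* $U$ from $N_w$ is the following operation. For every $v\in w$, let $M_{1}$ be the matroid on $S_v$ with independent sets $$\{I\subseteq S_v\cap U : |I|\le |S_v\cap U|-\lfloor x(S_v\cap U)\rfloor\},$$ let $M_{2}=M_{1}\vee N_v$ be the matroid union (its independent sets are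 the unions of an independent set of $M_{1}$ and an independent set of $N_v$), let $M_{3}=M_{2}/(S_v\cap U)$ be obtained from $M_2$ by contracting $S_v\cap U$, and let $N'_v$ be the disjoint union of $M_{3}$ and the free matroid on $S_v\cap U$. Let $N'_w$ be the disjoint union of the matroids $N'_v$, $v\in w$. Then the following hold. 1. $N'_w$ is a matroid with ground set $\delta(w)$, and it is the disjoint union of the matroids $N'_v$, $v\in w$, where $N'_v$ has ground set $S_v$. 2. The edges of $U$ are free elements of $N'_w$: if $I$ is independent in $N'_w$, then $I\cup U$ is independent in $N'_w$. 3. For every $v\in w$ and every independent set $I$ of $N'_v$ there is a set $R\subseteq I$ with $|R|\le\lceil |U|-x(U)\rceil$ such that $I\setminus R$ is independent in $N_v$. 4. $x$ is still feasible with respect to $N'_w$, that is, $x|_{\delta(w)}\in P_{N'_w}$. -/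

import Mathlib

open Set

namespace DegreeBoundedMST

noncomputable section

/-! ### Matroid constructions -/

/-- The augmentation step for the union of two matroids: if `I₁ ∪ I₂` and `J₁ ∪ J₂` are disjoint
unions of independent sets, the first one smaller, then the first one can be augmented. -/
theorem union_aug_aux {E : Type*} [Finite E] (n : ℕ) :
    ∀ (M₁ M₂ : Matroid E) (I₁ I₂ J₁ J₂ : Set E),
      M₁.Indep I₁ → M₂.Indep I₂ → M₁.Indep J₁ → M₂.Indep J₂ →
      Disjoint I₁ I₂ → Disjoint J₁ J₂ →
      (I₁ ∪ I₂).ncard < (J₁ ∪ J₂).ncard → (I₁ ∩ J₂).ncard + (I₂ ∩ J₁).ncard = n →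
      ∃ e ∈ J₁ ∪ J₂, e ∉ I₁ ∪ I₂ ∧
        ∃ K₁ K₂, M₁.Indep K₁ ∧ M₂.Indep K₂ ∧ insert e (I₁ ∪ I₂) = K₁ ∪ K₂ := by
  induction n using Nat.strong_induction_on with
  | _ n ih =>
  intro M₁ M₂ I₁ I₂ J₁ J₂ hI₁ hI₂ hJ₁ hJ₂ hI hJ hcard hn
  wlog hlt : I₁.ncard < J₁.ncard generalizing M₁ M₂ I₁ I₂ J₁ J₂
  · have hc := hcard
    rw [ncard_union_eq hI, ncard_union_eq hJ] at hc
    obtain ⟨e, heJ, heI, K₁, K₂, hK₁, hK₂, hK⟩ := this M₂ M₁ I₂ I₁ J₂ J₁ hI₂ hI₁ hJ₂ hJ₁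
      hI.symm hJ.symm (by rwa [union_comm I₂, union_comm J₂]) (by omega) (by omega)
    exact ⟨e, by rwa [union_comm], by rwa [union_comm], K₂, K₁, hK₂, hK₁,
      by rw [union_comm I₁, hK, union_comm]⟩
  obtain ⟨e, he, hins⟩ := hI₁.augment hJ₁ (by
    rw [← (toFinite I₁).cast_ncard_eq, ← (toFinite J₁).cast_ncard_eq]; exact_mod_cast hlt)
  by_cases heI : e ∈ I₂
  · have heJ₂ : e ∉ J₂ := fun h => hJ.ne_of_mem he.1 h rfl
    have hU : insert e I₁ ∪ I₂ \ {e} = I₁ ∪ I₂ := by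
      ext a; by_cases h : a = e <;> simp [h, heI]
    have h1 : insert e I₁ ∩ J₂ = I₁ ∩ J₂ := insert_inter_of_notMem heJ₂
    have h2 : ((I₂ \ {e}) ∩ J₁).ncard < (I₂ ∩ J₁).ncard :=
      ncard_lt_ncard ⟨inter_subset_inter_left _ sdiff_subset,
        fun h => (h ⟨heI, he.1⟩).1.2 rfl⟩
    have := ih _ (by rw [← hn, h1]; exact Nat.add_lt_add_left h2 _) M₁ M₂ (insert e I₁)
      (I₂ \ {e}) J₁ J₂ hins (hI₂.subset sdiff_subset) hJ₁ hJ₂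
      (by
        rw [disjoint_left] at hI ⊢
        rintro a (rfl | ha) h
        · exact h.2 rfl
        · exact hI ha h.1) hJ (by rwa [hU]) rfl
    rwa [hU] at this
  · exact ⟨e, Or.inl he.1, by simp [he.2, heI], insert e I₁, I₂, hins, hI₂, by rw [insert_union]⟩

/-- The union `M₁ ∨ M₂` of two matroids: a set is independent if and only if it is the union of
an independent set of `M₁` and an independent set of `M₂`. -/
def matroidUnion {E : Type*} [Finite E] (M₁ M₂ : Matroid E) : Matroid E :=
  (IndepMatroid.ofFinite (E := M₁.E ∪ M₂.E) (toFinite _)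
    (fun I => ∃ I₁ I₂, M₁.Indep I₁ ∧ M₂.Indep I₂ ∧ I = I₁ ∪ I₂)
    ⟨∅, ∅, M₁.empty_indep, M₂.empty_indep, by simp⟩
    (by
      rintro I _ ⟨I₁, I₂, h₁, h₂, rfl⟩ hI
      exact ⟨I ∩ I₁, I ∩ I₂, h₁.subset inter_subset_right, h₂.subset inter_subset_right,
        by rw [← inter_union_distrib_left, inter_eq_self_of_subset_left hI]⟩)
    (by
      rintro _ _ ⟨I₁, I₂, hI₁, hI₂, rfl⟩ ⟨J₁, J₂, hJ₁, hJ₂, rfl⟩ hlt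
      have := union_aug_aux _ M₁ M₂ I₁ (I₂ \ I₁) J₁ (J₂ \ J₁) hI₁ (hI₂.subset sdiff_subset) hJ₁
        (hJ₂.subset sdiff_subset) disjoint_sdiff_right disjoint_sdiff_right
        (by simpa only [union_sdiff_self] using hlt) rfl
      simpa only [union_sdiff_self] using this)
    (by
      rintro _ ⟨I₁, I₂, h₁, h₂, rfl⟩
      exact union_subset_union h₁.subset_ground h₂.subset_ground)).matroid

theorem matroidUnion_ground {E : Type*} [Finite E] (M₁ M₂ : Matroid E) :
    (matroidUnion M₁ M₂).E = M₁.E ∪ M₂.E := rfl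

theorem matroidUnion_indep_iff {E : Type*} [Finite E] (M₁ M₂ : Matroid E) (I : Set E) :
    (matroidUnion M₁ M₂).Indep I ↔ ∃ I₁ I₂, M₁.Indep I₁ ∧ M₂.Indep I₂ ∧ I = I₁ ∪ I₂ := Iff.rfl

/-- The matroid on the ground set `S` whose independent sets are the subsets of `S ∩ U` with at
most `k` elements. -/
def truncatedFree {E : Type*} [Finite E] (S U : Set E) (k : ℕ) : Matroid E :=
  (IndepMatroid.ofFinite (E := S) (toFinite _)
    (fun I => I ⊆ S ∩ U ∧ I.ncard ≤ k)
    (by simp)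
    (fun I J hJ hIJ => ⟨hIJ.trans hJ.1, (ncard_le_ncard hIJ).trans hJ.2⟩)
    (by
      intro I J hI hJ hlt
      obtain ⟨e, heJ, heI⟩ := exists_mem_notMem_of_ncard_lt_ncard hlt
      exact ⟨e, heJ, heI, insert_subset (hJ.1 heJ) hI.1,
        (ncard_insert_le e I).trans (Nat.succ_le_of_lt (hlt.trans_le hJ.2))⟩)
    (fun I hI => hI.1.trans inter_subset_left)).matroid

theorem truncatedFree_ground {E : Type*} [Finite E] (S U : Set E) (k : ℕ) :
    (truncatedFree S U k).E = S := rfl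

theorem truncatedFree_indep_iff {E : Type*} [Finite E] (S U : Set E) (k : ℕ) (I : Set E) :
    (truncatedFree S U k).Indep I ↔ I ⊆ S ∩ U ∧ I.ncard ≤ k := Iff.rfl

/-- The matroid polytope `P_M ⊆ ℝ^E` of a matroid `M` with ground set `E` and rank function `r`:
all `y ≥ 0` with `y(A) ≤ r(A)` for every `A ⊆ E`. -/
def matroidPolytope {E : Type*} (M : Matroid E) : Set (M.E → ℝ) :=
  {y | (∀ e, 0 ≤ y e) ∧
    ∀ A : Set M.E, ∑ᶠ e ∈ A, y e ≤ ((M.eRk (Subtype.val '' A)).toNat : ℝ)}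

/-- `x(A) = ∑_{e ∈ A} x(e)`. -/
def weight {E : Type*} (x : E → ℝ) (A : Set E) : ℝ := ∑ᶠ e ∈ A, x e

/-! ### Nodes and their degree constraints

`G` is the original (multi)graph, `F` is the set of edges of the current graph, and a node `w` of
the current graph is identified with the set of the vertices of `G` it contains. -/

/-- `δ(w)`: the edges of the current graph with exactly one endpoint in the node `w`. -/
def nodeCut {V E : Type*} (G : Graph V E) (F : Set E) (w : Set V) : Set E :=
  {f | f ∈ F ∧ ∃ v ∈ w, ∃ u, u ∉ w ∧ G.IsLink f v u}

/-- The edges in `δ(w)` that are adjacent to the vertex `v`. -/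
def vertexCut {V E : Type*} (G : Graph V E) (F : Set E) (w : Set V) (v : V) : Set E :=
  {f | f ∈ nodeCut G F w ∧ G.Inc f v}

theorem vertexCut_disjoint {V E : Type*} (G : Graph V E) (F : Set E) (w : Set V) {v v' : V}
    (hv : v ∈ w) (hv' : v' ∈ w) (hne : v ≠ v') :
    Disjoint (vertexCut G F w v) (vertexCut G F w v') := by
  rw [disjoint_left]
  rintro f ⟨⟨-, a, -, u, hu, hl⟩, h⟩ ⟨-, h'⟩
  rcases h.eq_or_eq_of_isLink hl with rfl | rfl
  · rcases h'.eq_or_eq_of_isLink hl with rfl | rfl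
    · exact hne rfl
    · exact hu hv'
  · exact hu hv

/-- A degree constraint of the node `w`, given by its decomposition into matroids `N_v`, `v ∈ w`,
where `N_v` has as ground set the edges of `δ(w)` that are adjacent to `v`. -/
structure NodeConstraint {V E : Type*} (G : Graph V E) (F : Set E) (w : Set V) where
  /-- The matroid `N_v` of a vertex `v` in the node. -/
  part : w → Matroid E
  ground_part : ∀ v : w, (part v).E = vertexCut G F w v

theorem NodeConstraint.pairwise_disjoint {V E : Type*} {G : Graph V E} {F : Set E} {w : Set V}
    (N : NodeConstraint G F w) :
    Pairwise (Function.onFun Disjoint fun v : w => (N.part v).E) := by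
  intro v v' hne
  simp only [Function.onFun, N.ground_part]
  exact vertexCut_disjoint G F w v.2 v'.2 fun h => hne (Subtype.ext h)

/-- The matroid `N_w`: the disjoint union of the matroids `N_v`, `v ∈ w`. -/
def NodeConstraint.matroid {V E : Type*} {G : Graph V E} {F : Set E} {w : Set V}
    (N : NodeConstraint G F w) : Matroid E :=
  Matroid.disjointSigma N.part N.pairwise_disjoint

/-! ### The removal operation -/

/-- With `S` the ground set of `N`, and for a point `x` whose restriction to `S` is in the matroid
polytope of `N` (so that `0 ≤ x(S ∩ U) ≤ |S ∩ U|` and `toNat` changes nothing): let `M₁` be the matroid on `S` whose independent sets are the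
`I ⊆ S ∩ U` with `|I| ≤ |S ∩ U| - ⌊x(S ∩ U)⌋`, let `M₂ = M₁ ∨ N` and `M₃ = M₂ / (S ∩ U)`.
The result is the disjoint union of `M₃` and the free matroid on `S ∩ U`. -/
def removePart {E : Type*} [Finite E] (N : Matroid E) (U : Set E) (x : E → ℝ) : Matroid E :=
  let M₁ := truncatedFree N.E U (((N.E ∩ U).ncard : ℤ) - ⌊weight x (N.E ∩ U)⌋).toNat
  let M₂ := matroidUnion M₁ N
  let M₃ := M₂.contract (N.E ∩ U)
  M₃.disjointSum (Matroid.freeOn (N.E ∩ U))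
    (by rw [Matroid.contract_ground, Matroid.freeOn_ground]; exact disjoint_sdiff_left)

theorem removePart_ground {E : Type*} [Finite E] (N : Matroid E) (U : Set E) (x : E → ℝ) :
    (removePart N U x).E = N.E := by
  simp only [removePart, Matroid.disjointSum_ground_eq, Matroid.contract_ground,
    matroidUnion_ground, truncatedFree_ground, Matroid.freeOn_ground, union_self]
  rw [sdiff_union_of_subset inter_subset_left]

/-- Removing the edge set `U` from a degree constraint: every `N_v` is replaced by the matroid
`removePart N_v U x`. -/
def NodeConstraint.remove {V E : Type*} [Finite E] {G : Graph V E} {F : Set E} {w : Set V}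
    (N : NodeConstraint G F w) (U : Set E) (x : E → ℝ) : NodeConstraint G F w where
  part v := removePart (N.part v) U x
  ground_part v := by rw [removePart_ground, N.ground_part]

/-- The properties required from a degree constraint `N'_w` with parts `N'_v`, `v ∈ w`, that is
obtained from `N_w` by removing `U`, where `x` is the current LP solution. -/
structure RemovalProperty {V E : Type*} {G : Graph V E} {F : Set E} {w : Set V}
    (N : NodeConstraint G F w) (U : Set E) (x : E → ℝ)
    (Nw' : Matroid E) (N' : w → Matroid E) : Prop where
  /-- `N'_w` is a matroid over `δ(w)`. -/
  ground : Nw'.E = nodeCut G F w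
  /-- `N'_w` is the disjoint union of the matroids `N'_v`, each of them on the edges of `δ(w)`
  that are adjacent to `v`. -/
  disjoint_union : (∀ v : w, (N' v).E = vertexCut G F w v) ∧
    ∃ h : Pairwise (Function.onFun Disjoint fun v : w => (N' v).E),
      Nw' = Matroid.disjointSigma N' h
  /-- The edges of `U` are free elements of `N'_w`. -/
  free : ∀ I, Nw'.Indep I → Nw'.Indep (I ∪ U)
  /-- Every independent set of `N'_v` becomes independent in `N_v` after the removal of at most
  `⌈|U| - x(U)⌉` edges. -/
  transform : ∀ (v : w) (I : Set E), (N' v).Indep I →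
    ∃ R ⊆ I, (R.ncard : ℤ) ≤ ⌈(U.ncard : ℝ) - weight x U⌉ ∧ (N.part v).Indep (I \ R)
  /-- The restriction of `x` to the ground set `δ(w)` of `N'_w` is in the polytope of `N'_w`. -/
  feasible : Nw'.E.domRestrict x ∈ matroidPolytope Nw'

end

end DegreeBoundedMST

namespace DegreeBoundedMST

/-! ### Weights of finite sets. -/

section Weight

variable {E : Type*}

/-! Fix `v` and put `T = S_v ∩ U`, `k = |T| - ⌊x(T)⌋`. Feasibility gives `T` an `N_v`-basis of size
at least `⌊x(T)⌋`; `M₁` covers the rest, so `T` is independent in `M₂`. Hence `I` is independent in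
`N'_v` exactly when `I ∪ T` is independent in `M₂` (`removePart_indep_iff`). Freeness of `U` is then
immediate, and the `M₁`-part of such a union is the set `R` to discard; `k ≤ ⌈|U| - x(U)⌉` since `x
≤ 1` on `U`.

The main point is feasibility, `exists_removePart_indep_of_subset`: every `A ⊆ S_v` contains an
`N'_v`-independent set of size at least `x(A)`. The node follows because the polytope of a direct
sum splits into those of its summands. -/

theorem weight_union [Finite E] (x : E → ℝ) {A B : Set E} (h : Disjoint A B) :
    weight x (A ∪ B) = weight x A + weight x B :=
  finsum_mem_union h (toFinite _) (toFinite _)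

theorem weight_le_ncard [Finite E] {x : E → ℝ} {A : Set E} (h : ∀ e ∈ A, x e ≤ 1) :
    weight x A ≤ A.ncard := by
  classical
  have hA : A.Finite := toFinite A
  rw [weight, finsum_mem_eq_finite_toFinset_sum _ hA, ncard_eq_toFinset_card A hA]
  simpa using Finset.sum_le_card_nsmul hA.toFinset x 1 (by simpa using h)

theorem weight_singleton (x : E → ℝ) (e : E) : weight x {e} = x e :=
  finsum_mem_singleton

end Weight

/-! ### The matroid polytope and its behaviour under direct sums. -/

section Polytope

variable {E : Type*} {M : Matroid E} {x : E → ℝ}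

theorem domRestrict_mem_matroidPolytope_iff :
    M.E.domRestrict x ∈ matroidPolytope M ↔
      (∀ e ∈ M.E, 0 ≤ x e) ∧ ∀ A ⊆ M.E, weight x A ≤ ((M.eRk A).toNat : ℝ) := by
  have key (A : Set M.E) :
      ∑ᶠ e ∈ A, M.E.domRestrict x e = weight x (Subtype.val '' A) :=
    (finsum_mem_image Subtype.val_injective.injOn).symm
  refine and_congr (by simp) ⟨fun h A hA => ?_, fun h A => ?_⟩
  · have := h (Subtype.val ⁻¹' A)
    rwa [key, Subtype.image_preimage_coe, inter_eq_self_of_subset_right hA] at this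
  · rw [key]
    exact h _ (Subtype.coe_image_subset _ _)

theorem ncard_le_toNat_eRk [Finite E] {I A : Set E} (hI : M.Indep I) (h : I ⊆ A) :
    I.ncard ≤ (M.eRk A).toNat := by
  obtain ⟨J, hJ, hIJ⟩ := hI.subset_isBasis'_of_subset h
  rw [hJ.eRk_eq_encard]
  exact ncard_le_ncard hIJ

theorem weight_le_ncard_of_isBasis (hx : M.E.domRestrict x ∈ matroidPolytope M) {I A : Set E}
    (hI : M.IsBasis I A) : weight x A ≤ I.ncard := by
  have := (domRestrict_mem_matroidPolytope_iff.1 hx).2 A hI.subset_ground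
  rwa [hI.eRk_eq_encard] at this

theorem le_one_of_mem_matroidPolytope [Finite E]
    (hx : M.E.domRestrict x ∈ matroidPolytope M) {e : E} (he : e ∈ M.E) : x e ≤ 1 := by
  obtain ⟨I, hI⟩ := M.exists_isBasis {e} (by simpa using he)
  have h := weight_le_ncard_of_isBasis hx hI
  have h1 : I.ncard ≤ 1 := (ncard_le_ncard hI.subset).trans_eq (ncard_singleton e)
  rw [weight_singleton] at h
  exact h.trans (by exact_mod_cast h1)

/-- A basis of `A` in the direct sum restricts to a basis of each `A ∩ (M i).E`, so the rank
constraints add up over the parts. -/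
theorem domRestrict_mem_matroidPolytope_disjointSigma_iff [Finite E] {ι : Type*}
    {M : ι → Matroid E} (h : Pairwise (Function.onFun Disjoint fun i => (M i).E)) :
    (Matroid.disjointSigma M h).E.domRestrict x ∈ matroidPolytope (Matroid.disjointSigma M h) ↔
      ∀ i, (M i).E.domRestrict x ∈ matroidPolytope (M i) := by
  refine ⟨fun hx i => ?_, fun hx => ?_⟩
  · rw [domRestrict_mem_matroidPolytope_iff]
    have hsub : (M i).E ⊆ (Matroid.disjointSigma M h).E := by
      rw [Matroid.disjointSigma_ground_eq]
      exact subset_iUnion (fun i => (M i).E) i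
    refine ⟨fun e he => (domRestrict_mem_matroidPolytope_iff.1 hx).1 e (hsub he),
      fun A hA => ?_⟩
    obtain ⟨I, hI⟩ := (Matroid.disjointSigma M h).exists_isBasis A (hA.trans hsub)
    have hi := (Matroid.disjointSigma_indep_iff.1 hI.indep).1 i
    rw [inter_eq_self_of_subset_left (hI.subset.trans hA)] at hi
    exact (weight_le_ncard_of_isBasis hx hI).trans
      (by exact_mod_cast ncard_le_toNat_eRk hi hI.subset)
  · rw [domRestrict_mem_matroidPolytope_iff]
    refine ⟨fun e he => ?_, fun A hA => ?_⟩
    · rw [Matroid.disjointSigma_ground_eq, mem_iUnion] at he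
      obtain ⟨i, hi⟩ := he
      exact (domRestrict_mem_matroidPolytope_iff.1 (hx i)).1 e hi
    obtain ⟨I, hI⟩ := (Matroid.disjointSigma M h).exists_isBasis A hA
    have hB := Matroid.disjointSigma_isBasis_iff.1 hI
    rw [Matroid.disjointSigma_ground_eq] at hA
    rw [hI.eRk_eq_encard]
    -- The index type may be infinite, but the finite set `A` meets only finitely many parts.
    obtain ⟨s, hs, hAs⟩ : ∃ s : Set ι, s.Finite ∧ A ⊆ ⋃ i ∈ s, (M i).E := by
      obtain ⟨s, hs, hAs⟩ := finite_subset_iUnion (toFinite A) hA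
      exact ⟨s, hs, hAs⟩
    have hdis (B : Set E) : s.PairwiseDisjoint fun i => B ∩ (M i).E :=
      fun i _ j _ hij => (h hij).mono inter_subset_right inter_subset_right
    have hdec (y : E → ℝ) {B : Set E} (hBA : B ⊆ A) :
        weight y B = ∑ᶠ i ∈ s, weight y (B ∩ (M i).E) := by
      have hU : B = ⋃ i ∈ s, B ∩ (M i).E := by
        rw [← inter_iUnion₂, inter_eq_self_of_subset_left (hBA.trans hAs)]
      conv_lhs => rw [hU]
      exact finsum_mem_biUnion (hdis B) hs fun i _ => toFinite _
    have hcard (B : Set E) : (B.ncard : ℝ) = weight (fun _ => 1) B := by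
      have hf : B.Finite := toFinite B
      rw [weight, finsum_mem_eq_finite_toFinset_sum _ hf, ncard_eq_toFinset_card B hf]
      simp
    change weight x A ≤ (I.ncard : ℝ)
    rw [hcard, hdec x Subset.rfl, hdec _ hB.2.1, finsum_mem_eq_finite_toFinset_sum _ hs,
      finsum_mem_eq_finite_toFinset_sum _ hs]
    refine Finset.sum_le_sum fun i _ => ?_
    rw [← hcard]
    exact weight_le_ncard_of_isBasis (hx i) (hB.1 i)

end Polytope

/-! ### Removal at a single vertex. -/

section RemovePart

variable {E : Type*} [Finite E] {N : Matroid E} {U : Set E} {x : E → ℝ}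

/-- The truncation level used in `removePart`, without truncated subtraction. -/
theorem removePart_level_eq (hx : N.E.domRestrict x ∈ matroidPolytope N) :
    (((((N.E ∩ U).ncard : ℤ) - ⌊weight x (N.E ∩ U)⌋).toNat : ℕ) : ℤ) =
      ((N.E ∩ U).ncard : ℤ) - ⌊weight x (N.E ∩ U)⌋ := by
  refine Int.toNat_of_nonneg (sub_nonneg.2 ?_)
  have h : weight x (N.E ∩ U) ≤ (N.E ∩ U).ncard :=
    weight_le_ncard fun e he => le_one_of_mem_matroidPolytope hx he.1
  simpa using Int.floor_le_floor h

theorem matroidUnion_truncatedFree_indep_of_subset (hx : N.E.domRestrict x ∈ matroidPolytope N) :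
    (matroidUnion (truncatedFree N.E U
      (((N.E ∩ U).ncard : ℤ) - ⌊weight x (N.E ∩ U)⌋).toNat) N).Indep (N.E ∩ U) := by
  obtain ⟨J, hJ⟩ := N.exists_isBasis (N.E ∩ U) inter_subset_left
  refine ⟨(N.E ∩ U) \ J, J, ⟨sdiff_subset, ?_⟩, hJ.indep, (sdiff_union_of_subset hJ.subset).symm⟩
  have hfl : ⌊weight x (N.E ∩ U)⌋ ≤ J.ncard := by
    simpa using Int.floor_le_floor (weight_le_ncard_of_isBasis hx hJ)
  have hk := removePart_level_eq (U := U) hx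
  have hc := ncard_sdiff_add_ncard_of_subset hJ.subset
  omega

/-- If `x` is feasible for `N`, then `I` is independent after removing `U` if and only if the union
of `I` and the removed elements is independent in the matroid union. -/
theorem removePart_indep_iff (hx : N.E.domRestrict x ∈ matroidPolytope N) {I : Set E} :
    (removePart N U x).Indep I ↔ I ⊆ N.E ∧ (matroidUnion (truncatedFree N.E U
      (((N.E ∩ U).ncard : ℤ) - ⌊weight x (N.E ∩ U)⌋).toNat) N).Indep (I ∪ N.E ∩ U) := by
  have hT := matroidUnion_truncatedFree_indep_of_subset (U := U) hx
  have hE : N.E \ (N.E ∩ U) ∪ N.E ∩ U = N.E := sdiff_union_of_subset inter_subset_left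
  simp only [removePart, Matroid.disjointSum_indep_iff, Matroid.contract_ground,
    matroidUnion_ground, truncatedFree_ground, Matroid.freeOn_ground, union_self,
    Matroid.freeOn_indep_iff, inter_subset_right, true_and, hE]
  rw [hT.contract_indep_iff, and_iff_right (disjoint_sdiff_left.mono_left inter_subset_right),
    and_comm]
  refine and_congr_right fun hI => ?_
  rw [← inter_sdiff_assoc, inter_eq_self_of_subset_left hI, sdiff_union_self]

theorem removePart_indep_union (hx : N.E.domRestrict x ∈ matroidPolytope N) {I : Set E}
    (hI : (removePart N U x).Indep I) : (removePart N U x).Indep (I ∪ N.E ∩ U) := by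
  rw [removePart_indep_iff hx] at hI ⊢
  exact ⟨union_subset hI.1 inter_subset_left, by rw [union_assoc, union_self]; exact hI.2⟩

theorem exists_indep_sdiff_of_removePart_indep (hx : N.E.domRestrict x ∈ matroidPolytope N)
    {I : Set E} (hI : (removePart N U x).Indep I) :
    ∃ R ⊆ I, (R.ncard : ℤ) ≤ ((N.E ∩ U).ncard : ℤ) - ⌊weight x (N.E ∩ U)⌋ ∧
      N.Indep (I \ R) := by
  obtain ⟨-, A, B, hA, hB, hAB⟩ := (removePart_indep_iff hx).1 hI
  refine ⟨I ∩ A, inter_subset_left, ?_, hB.subset ?_⟩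
  · rw [← removePart_level_eq hx]
    exact_mod_cast (ncard_le_ncard inter_subset_right).trans hA.2
  · rw [sdiff_self_inter]
    rintro e ⟨he, heA⟩
    exact (hAB.subset (Or.inl he)).resolve_left heA

/-- As `T` is free, the witness contains `A ∩ T`, which pays for `x(A ∩ T)`. It remains to find `K`
with `K ∪ T` independent in the union and `|K \ T| ≥ x(A \ T)`. -/
theorem exists_removePart_indep_of_subset (hx : N.E.domRestrict x ∈ matroidPolytope N)
    {A : Set E} (hA : A ⊆ N.E) :
    ∃ I ⊆ A, (removePart N U x).Indep I ∧ weight x A ≤ I.ncard := by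
  have hk := removePart_level_eq (U := U) hx
  have hTi := matroidUnion_truncatedFree_indep_of_subset (U := U) hx
  have hiff {I : Set E} := removePart_indep_iff (U := U) hx (I := I)
  have hTE : N.E ∩ U ⊆ N.E := inter_subset_left
  have htf {k : ℕ} {I : Set E} : (truncatedFree N.E U k).Indep I ↔ _ :=
    truncatedFree_indep_iff N.E U k I
  generalize (((N.E ∩ U).ncard : ℤ) - ⌊weight x (N.E ∩ U)⌋).toNat = k at hk hTi hiff
  generalize N.E ∩ U = T at hk hTi hiff hTE htf
  have hwA : weight x A = weight x (A \ T) + weight x (A ∩ T) := by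
    rw [← weight_union x (disjoint_sdiff_left.mono_right inter_subset_right), sdiff_union_inter]
  have hwAT : weight x (A ∩ T) ≤ (A ∩ T).ncard :=
    weight_le_ncard fun e he => le_one_of_mem_matroidPolytope hx (hA he.1)
  have hI_union (K : Set E) : K \ T ∪ A ∩ T ∪ T = K ∪ T := by
    rw [union_assoc, union_eq_self_of_subset_left inter_subset_right, sdiff_union_self]
  have hI_card (K : Set E) : (K \ T ∪ A ∩ T).ncard = (K \ T).ncard + (A ∩ T).ncard :=
    ncard_union_eq (disjoint_sdiff_left.mono_right inter_subset_right)
  have hdis {B : Set E} (hB : B ⊆ A ∪ T) : B \ T ∪ A ∩ T ⊆ A :=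
    union_subset (fun e he => (hB he.1).resolve_right he.2) inter_subset_left
  obtain ⟨B, hB⟩ := N.exists_isBasis (A \ T) (sdiff_subset.trans hA)
  have hBT : B \ T = B :=
    (disjoint_sdiff_left.mono_left hB.subset).sdiff_eq_left
  obtain ⟨J, hJ, hBJ⟩ := hB.indep.subset_isBasis_of_subset
    (hB.subset.trans (sdiff_subset.trans subset_union_left)) (union_subset hA hTE)
  -- If `M₁` can cover all of `T \ J`, then `B ∪ T` is independent in the union and `|B| ≥ x(A \
  -- T)`. Otherwise `M₁` can contribute a full `k` elements outside `J`.
  by_cases hcase : (T \ J).ncard ≤ k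
  · refine ⟨B \ T ∪ A ∩ T, hdis (hB.subset.trans (sdiff_subset.trans subset_union_left)),
      hiff.2 ⟨(hdis (hB.subset.trans (sdiff_subset.trans subset_union_left))).trans hA, ?_⟩, ?_⟩
    · rw [hI_union]
      refine ⟨T \ J, B ∪ J ∩ T, htf.2 ⟨sdiff_subset, hcase⟩,
        hJ.indep.subset (union_subset hBJ inter_subset_left), ?_⟩
      rw [union_left_comm, inter_comm, sdiff_union_inter]
    · have := weight_le_ncard_of_isBasis hx hB
      rw [hI_card, hBT, hwA]
      push_cast
      linarith
  · obtain ⟨C, hC, hCk⟩ := exists_subset_card_eq (not_le.1 hcase).le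
    obtain ⟨K, hK, hTK⟩ := hTi.subset_isBasis_of_subset (subset_union_right (s := A)) (by
      rw [matroidUnion_ground, truncatedFree_ground, union_self]
      exact union_subset hA hTE)
    have hJC : (J ∪ C).ncard ≤ K.ncard := by
      have hi : (matroidUnion (truncatedFree N.E U k) N).Indep (J ∪ C) :=
        ⟨C, J, htf.2 ⟨hC.trans sdiff_subset, hCk.le⟩, hJ.indep, union_comm _ _⟩
      have := ncard_le_toNat_eRk hi
        (union_subset hJ.subset ((hC.trans sdiff_subset).trans subset_union_right))
      rwa [hK.eRk_eq_encard] at this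
    rw [ncard_union_eq (disjoint_sdiff_right.mono_right hC), hCk] at hJC
    refine ⟨K \ T ∪ A ∩ T, hdis hK.subset, hiff.2 ⟨(hdis hK.subset).trans hA, ?_⟩, ?_⟩
    · rw [hI_union, union_eq_self_of_subset_right hTK]
      exact hK.indep
    · have hKc := ncard_sdiff_add_ncard_of_subset hTK
      have hw := weight_le_ncard_of_isBasis hx hJ
      rw [← sdiff_union_self, weight_union x disjoint_sdiff_left] at hw
      have hfl := Int.floor_le (weight x T)
      -- `|K \ T| ≥ |J| + k - |T| = |J| - ⌊x(T)⌋`, and `|J| ≥ x(A ∪ T) = x(A \ T) + x(T)`.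
      have hz : (J.ncard : ℤ) - ⌊weight x T⌋ ≤ (K \ T).ncard := by omega
      have hr : (J.ncard : ℝ) - ⌊weight x T⌋ ≤ (K \ T).ncard := by exact_mod_cast hz
      rw [hI_card, hwA]
      push_cast
      linarith

theorem domRestrict_mem_matroidPolytope_removePart (U : Set E)
    (hx : N.E.domRestrict x ∈ matroidPolytope N) :
    (removePart N U x).E.domRestrict x ∈ matroidPolytope (removePart N U x) := by
  rw [domRestrict_mem_matroidPolytope_iff, removePart_ground]
  refine ⟨(domRestrict_mem_matroidPolytope_iff.1 hx).1, fun A hA => ?_⟩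
  obtain ⟨I, hIA, hI, hw⟩ := exists_removePart_indep_of_subset (U := U) hx hA
  exact hw.trans (by exact_mod_cast ncard_le_toNat_eRk hI hIA)

end RemovePart

/-! ### From the vertices to the node. -/

section Node

variable {V E : Type*} {G : Graph V E} {F : Set E} {w : Set V}

theorem NodeConstraint.matroid_ground (N : NodeConstraint G F w) :
    N.matroid.E = nodeCut G F w := by
  rw [NodeConstraint.matroid, Matroid.disjointSigma_ground_eq]
  ext f
  simp only [N.ground_part, mem_iUnion, Subtype.exists]
  constructor
  · rintro ⟨v, hv, hf, -⟩
    exact hf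
  · intro hf
    obtain ⟨-, v, hv, u, -, hl⟩ := id hf
    exact ⟨v, hv, hf, hl.inc_left⟩

end Node

end DegreeBoundedMST

theorem mainTheorem5 {V E : Type*} [Finite E] (G : Graph V E) (F : Set E) (w : Set V)
    (N : DegreeBoundedMST.NodeConstraint G F w) (U : Set E)
    (hU : U ⊆ DegreeBoundedMST.nodeCut G F w) (x : E → ℝ)
    (hx : N.matroid.E.domRestrict x ∈ DegreeBoundedMST.matroidPolytope N.matroid) :
    DegreeBoundedMST.RemovalProperty N U x (N.remove U x).matroid (N.remove U x).part := by
  have hpart := (DegreeBoundedMST.domRestrict_mem_matroidPolytope_disjointSigma_iff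
    N.pairwise_disjoint).1 hx
  refine ⟨(N.remove U x).matroid_ground, ⟨(N.remove U x).ground_part,
    (N.remove U x).pairwise_disjoint, rfl⟩, fun I hI => ?_, fun v I hI => ?_, ?_⟩
  · have hg := hI.subset_ground
    have hg' := (N.remove U x).matroid_ground
    have hI' := (Matroid.disjointSigma_indep_iff.1 hI).1
    refine Matroid.disjointSigma_indep_iff.2 ⟨fun v => ?_, ?_⟩
    · have := DegreeBoundedMST.removePart_indep_union (hpart v) (hI' v)
      have hE : ((N.remove U x).part v).E = (N.part v).E :=
        DegreeBoundedMST.removePart_ground _ _ _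
      rw [union_inter_distrib_right, inter_comm U, hE]
      rwa [hE] at this
    · rw [← Matroid.disjointSigma_ground_eq (h := (N.remove U x).pairwise_disjoint)]
      exact union_subset hg (hU.trans hg'.superset)
  · obtain ⟨R, hR, hcard, hRI⟩ :=
      DegreeBoundedMST.exists_indep_sdiff_of_removePart_indep (hpart v) hI
    refine ⟨R, hR, hcard.trans ?_, hRI⟩
    have hle : DegreeBoundedMST.weight x (U \ (N.part v).E) ≤ (U \ (N.part v).E).ncard := by
      refine DegreeBoundedMST.weight_le_ncard fun e he =>
        DegreeBoundedMST.le_one_of_mem_matroidPolytope hx ?_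
      rw [N.matroid_ground]
      exact hU he.1
    have hw : DegreeBoundedMST.weight x U = DegreeBoundedMST.weight x ((N.part v).E ∩ U) +
        DegreeBoundedMST.weight x (U \ (N.part v).E) := by
      rw [← DegreeBoundedMST.weight_union x (disjoint_sdiff_right.mono_left inter_subset_left),
        inter_comm, inter_union_sdiff]
    have hc : (U.ncard : ℝ) = ((N.part v).E ∩ U).ncard + (U \ (N.part v).E).ncard := by
      rw [inter_comm]
      exact_mod_cast (ncard_inter_add_ncard_sdiff_eq_ncard U _).symm
    have h := Int.le_ceil ((U.ncard : ℝ) - DegreeBoundedMST.weight x U)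
    -- The left side is an integer, so the floor can be dropped; edges of `U` outside `S_v` only
    -- help, since each has `x ≤ 1`.
    have hfl : ((N.part v).E ∩ U).ncard - ⌈(U.ncard : ℝ) - DegreeBoundedMST.weight x U⌉ ≤
        ⌊DegreeBoundedMST.weight x ((N.part v).E ∩ U)⌋ := by
      rw [Int.le_floor]
      push_cast
      linarith
    linarith
  · exact (DegreeBoundedMST.domRestrict_mem_matroidPolytope_disjointSigma_iff
      (N.remove U x).pairwise_disjoint).2 fun v =>
        DegreeBoundedMST.domRestrict_mem_matroidPolytope_removePart U (hpart v)
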